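/- Notation. $H_{n,d}$ is the space of real forms of degree $d$ in $n$ variables, $P_{n,2d}\subset H_{n,2d}$ the cone of nonnegative forms, $\Sigma_{n,2d}\subset P_{n,2d}$ the cone of finite sums of squares of forms in $H_{n,d}$, and $\Sigma_{n,2d}^*$ the cone of linear functionals on $H_{n,2d}$ that are nonnegative on $\Sigma_{n,2d}$. $\mathcal V(p)$ is the real projective variety of $p$; points of it are identified with affine representatives. (a) Ternary sextics. Let $p\in\partial P_{3,6}\setminus\Sigma_{3,6}$ and let $A=\{v_1,\dots,v_9\}\subset\mathbb R^3$ represent nine distinct projective points such that $\mathcal V(p)=\{v_1,\dots,v_k\}$ with $1\le k\le 8$. Assume that the projectivization of $A$ is the (complex) transverse intersection of two coprime real cubics $q_1,q_2\in H_{3,3}$, and that no four of the $v_j$ lie on a line and no seven on a quadric. Let $u=(u_1,\dots,u_9)\in\mathbb R^9\setminus\{0\}$ be the Cayley–Bacharach relation on $A$ (unique up to scaling), i.e. $\sum_{j=1}^9u_jf(v_j)=0$ for all $f\in H_{3,3}$, and assume $$(u_{k+1}^2+\cdots+u_8^2)\,(p(v_{k+1})+\cdots+p(v_8))<u_9^2\,p(v_9).$$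 Then there is $N_0\in\mathbb R$ such that for every real $N\ge N_0$, with $$a_1=\cdots=a_k=N,\qquad a_{k+1}=\cdots=a_8=1,\qquad a_9=\frac{-u_9^2}{\frac{u_1^2}{a_1}+\cdots+\frac{u_8^2}{a_8}},$$ the functional $l_a:H_{3,6}\to\mathbb R$, $f\mapsto\sum_{j=1}^9a_jf(v_j)$, is a certificate for $p\notin\Sigma_{3,6}$: it spans an extreme ray of $\Sigma_{3,6}^*$ and $l_a(p)<0$. (b) Quaternary quartics. Let $p\in\partial P_{4,4}\setminus\Sigma_{4,4}$ and let $A=\{v_1,\dots,v_8\}\subset\mathbb R^4$ represent eight distinct projective points such that $\mathcal V(p)=\{v_1,\dots,v_k\}$ with $1\le k\le 7$. Assume that the projectivization of $A$ is the (complex) transverse intersection of three coprime real quadrics $q_1,q_2,q_3\in H_{4,2}$, and that no five of the $v_j$ lie on a plane. Let $u\in\mathbb R^8\setminus\{0\}$ be the Cayley–Bacharach relation on $A$ (unique up to scaling), i.e. $\sum_{j=1}^8u_jf(v_j)=0$ for all $f\in H_{4,2}$, and assume $$(u_{k+1}^2+\cdots+u_7^2)\,(p(v_{k+1})+\cdots+p(v_7))<u_8^2\,p(v_8).$$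 Then there is $N_0\in\mathbb R$ such that for every real $N\ge N_0$, with $$a_1=\cdots=a_k=N,\qquad a_{k+1}=\cdots=a_7=1,\qquad a_8=\frac{-u_8^2}{\frac{u_1^2}{a_1}+\cdots+\frac{u_7^2}{a_7}},$$ the functional $l_a:H_{4,4}\to\mathbb R$, $f\mapsto\sum_{j=1}^8a_jf(v_j)$, is a certificate for $p\notin\Sigma_{4,4}$: it spans an extreme ray of $\Sigma_{4,4}^*$ and $l_a(p)<0$. In both cases, if all points $v_j$ of $A$ have rational coordinates and $N\ge N_0$ is rational, then all $a_j$ are rational. -/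

import Mathlib

noncomputable section

namespace SOSCertificate

/-- The space `H_{n,d}` of real forms (homogeneous polynomials) of degree `d` in `n` variables. -/
abbrev Form (n d : ℕ) : Type :=
  MvPolynomial.homogeneousSubmodule (Fin n) ℝ d

/-- Value of a form at a real point, as a linear functional of the form. -/
def evalAt {n d : ℕ} (x : Fin n → ℝ) : Form n d →ₗ[ℝ] ℝ :=
  (MvPolynomial.aeval (R := ℝ) x).toLinearMap ∘ₗ Submodule.subtype _

/-- The cone of forms that are nonnegative on `ℝⁿ`. A nonnegative form of positive degree lies on
the boundary of this cone exactly when it has a nonzero real zero. -/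
def psdCone (n d : ℕ) : Set (Form n d) :=
  {f | ∀ x : Fin n → ℝ, 0 ≤ evalAt x f}

/-- The cone `Σ_{n,2d}` of finite sums of squares of forms of degree `d`. -/
def sosCone (n d : ℕ) : Set (Form n (2 * d)) :=
  {f | ∃ (r : ℕ) (g : Fin r → Form n d),
    (f : MvPolynomial (Fin n) ℝ) = ∑ i, (g i : MvPolynomial (Fin n) ℝ) ^ 2}

/-- The dual cone `Σ_{n,2d}^*`. -/
def sosDual (n d : ℕ) : Set (Module.Dual ℝ (Form n (2 * d))) :=
  {l | ∀ f ∈ sosCone n d, 0 ≤ l f}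

/-- `l` spans an extreme ray of the cone `Σ_{n,2d}^*`. -/
def SpansExtremeRay {n d : ℕ} (l : Module.Dual ℝ (Form n (2 * d))) : Prop :=
  l ∈ sosDual n d ∧ l ≠ 0 ∧
    ∀ l₁ ∈ sosDual n d, ∀ l₂ ∈ sosDual n d, l₁ + l₂ = l →
      (∃ c : ℝ, 0 ≤ c ∧ l₁ = c • l) ∧ (∃ c : ℝ, 0 ≤ c ∧ l₂ = c • l)

/-- `l` certifies that `p` is not a sum of squares, and spans an extreme ray of the dual cone:
it is nonnegative on all sums of squares (this is part of `SpansExtremeRay`) and negative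
at `p`. -/
def IsExtremeCertificate {n d : ℕ} (l : Module.Dual ℝ (Form n (2 * d)))
    (p : Form n (2 * d)) : Prop :=
  SpansExtremeRay l ∧ l p < 0

/-- The functional `l_a : f ↦ ∑ j, a j * f (v j)`. -/
def pointFunctional {n m : ℕ} (d : ℕ) (v : Fin m → Fin n → ℝ) (a : Fin m → ℝ) :
    Module.Dual ℝ (Form n d) :=
  ∑ j, a j • evalAt (v j)

/-- The nonzero real zeros of `p` are exactly the nonzero multiples of the first `k` of the
points `v j`, i.e. the real projective variety of `p` is `{[v_1], …, [v_k]}`. -/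
def ZerosAreFirst {n d m : ℕ} (p : Form n d) (v : Fin m → Fin n → ℝ) (k : ℕ) : Prop :=
  ∀ x : Fin n → ℝ, x ≠ 0 →
    (evalAt x p = 0 ↔ ∃ j : Fin m, (j : ℕ) < k ∧ ∃ c : ℝ, x = c • v j)

/-- No `c + 1` of the points lie on a common hypersurface of degree `d`. -/
def AtMostOnHypersurface {n m : ℕ} (d c : ℕ) (v : Fin m → Fin n → ℝ) : Prop :=
  ∀ f : Form n d, f ≠ 0 → {j : Fin m | evalAt (v j) f = 0}.ncard ≤ c

/-- The coprime real forms `q i` intersect transversely, in complex projective space, precisely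
in the pairwise distinct real projective points `[v j]`. -/
structure IsTransverseIntersection {n d r m : ℕ} (q : Fin r → Form n d)
    (v : Fin m → Fin n → ℝ) : Prop where
  distinct : ∀ i j, i ≠ j → LinearIndependent ℝ ![v i, v j]
  coprime : ∀ g : MvPolynomial (Fin n) ℝ,
    (∀ i, g ∣ (q i : MvPolynomial (Fin n) ℝ)) → IsUnit g
  zeros : ∀ z : Fin n → ℂ, z ≠ 0 →
    ((∀ i, MvPolynomial.aeval z (q i : MvPolynomial (Fin n) ℝ) = 0) ↔
      ∃ (j : Fin m) (c : ℂ), z = fun t => c * (v j t : ℂ))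
  transverse : ∀ j, LinearIndependent ℝ (fun i : Fin r => fun t : Fin n =>
    MvPolynomial.eval (v j) (MvPolynomial.pderiv t (q i : MvPolynomial (Fin n) ℝ)))

/-- `u` is a (nontrivial) linear relation between the values at the points `v j` of all forms of
degree `d`. -/
def IsCayleyBacharachRelation {n m : ℕ} (d : ℕ) (v : Fin m → Fin n → ℝ) (u : Fin m → ℝ) : Prop :=
  u ≠ 0 ∧ ∀ f : Form n d, ∑ j, u j * evalAt (v j) f = 0

/-- The inequality
`(u_{k+1}² + ⋯ + u_m²) * (p(v_{k+1}) + ⋯ + p(v_m)) < u_{m+1}² * p(v_{m+1})`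
for `m + 1` points. -/
def RelaxationInequality {n d m : ℕ} (p : Form n d) (v : Fin (m + 1) → Fin n → ℝ)
    (u : Fin (m + 1) → ℝ) (k : ℕ) : Prop :=
  (∑ j ∈ Finset.univ.filter (fun j : Fin m => k ≤ (j : ℕ)), u j.castSucc ^ 2) *
      (∑ j ∈ Finset.univ.filter (fun j : Fin m => k ≤ (j : ℕ)), evalAt (v j.castSucc) p) <
    u (Fin.last m) ^ 2 * evalAt (v (Fin.last m)) p

/-- Blekherman's formula for the last coefficient in terms of the first `m` ones. -/
def blekhermanLast {m : ℕ} (u : Fin (m + 1) → ℝ) (a : Fin m → ℝ) : ℝ :=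
  -(u (Fin.last m) ^ 2) / ∑ j : Fin m, u j.castSucc ^ 2 / a j

/-- The coefficients `a_1 = ⋯ = a_k = N`, `a_{k+1} = ⋯ = a_m = 1`, with `a_{m+1}` given by
Blekherman's formula. -/
def explicitCoeff {m : ℕ} (u : Fin (m + 1) → ℝ) (k : ℕ) (N : ℝ) : Fin (m + 1) → ℝ :=
  let a : Fin m → ℝ := fun j => if (j : ℕ) < k then N else 1
  Fin.snoc (α := fun _ => ℝ) a (blekhermanLast u a)

end SOSCertificate

end

open SOSCertificate

noncomputable section

namespace SOSCertificate

open MvPolynomial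

/-! Both parts are instances of `exists_isExtremeCertificate`: `r` forms of degree `d` meet
transversely in `m + 1` points, and every nonzero relation among the values of degree `d` forms
there involves all points, so it is a multiple of `u`.

Nonnegativity on squares is a weighted Cauchy–Schwarz inequality: the relation expresses `u_last
f(v_last)` through the other values, and Blekherman's formula is the borderline weight, equivalently
`∑ u_j² / a_j = 0`.

For extremality, let `l₁` be a summand of `l_a` in the dual cone. It kills every multiple of a form
`w` with `l_a(w²) = 0`. With `w = q_i`, it kills the degree `2d` part of the ideal of the `q_i`; by
a dimension count using Koszul syzygies this part is all forms vanishing at the points, so `l₁` is a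
combination of point evaluations with weights `b`. With `w = g`, where `g(v_j) = u_j / a_j`, the
vector `b_j u_j / a_j` is a relation, hence a multiple of `u`, and so `b` is a multiple of `a`.

Negativity at `p` is the limit `N → ∞`, where the given inequality is strict. Full support of
relations is projective geometry: a relation missing one point is tested on products of lines and
conics (for cubics) or of two planes (for quadrics). -/

theorem evalAt_apply {n d : ℕ} (x : Fin n → ℝ) (f : Form n d) :
    evalAt x f = MvPolynomial.eval x (f : MvPolynomial (Fin n) ℝ) := by
  simp [evalAt, MvPolynomial.aeval_eq_eval]

theorem homogeneousSubmodule_eq_restrictSupport (n d : ℕ) :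
    homogeneousSubmodule (Fin n) ℝ d = restrictSupport ℝ {c : Fin n →₀ ℕ | c.degree = d} :=
  homogeneousSubmodule_eq_finsupp_supported _ _ _

instance finite_form (n d : ℕ) : Module.Finite ℝ (Form n d) :=
  Module.Finite.iff_fg.mpr (homogeneousSubmodule_fg (Fin n) ℝ d)

theorem finrank_form (n d : ℕ) : Module.finrank ℝ (Form n d) = (n + d - 1).choose d := by
  have h := Module.finrank_eq_nat_card_basis
    (basisRestrictSupport ℝ {c : Fin n →₀ ℕ | c.degree = d})
  rw [← homogeneousSubmodule_eq_restrictSupport] at h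
  rw [h]
  have h2 : {c : Fin n →₀ ℕ | c.degree = d} =
      ((Finset.finsuppAntidiag (Finset.univ : Finset (Fin n)) d : Finset _) : Set _) := by
    ext c
    simp [Finset.mem_finsuppAntidiag, Finsupp.degree_eq_sum]
  rw [h2, Nat.card_coe_set_eq, Set.ncard_coe_finset,
    Finset.card_finsuppAntidiag_nat_eq_multichoose, Finset.card_univ, Fintype.card_fin,
    Nat.multichoose_eq]

/-- The product of two forms. -/
def Form.mul {n d e k : ℕ} (h : d + e = k) (f : Form n d) (g : Form n e) : Form n k :=
  ⟨f * g, h ▸ IsHomogeneous.mul f.2 g.2⟩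

theorem Form.coe_mul {n d e k : ℕ} (h : d + e = k) (f : Form n d) (g : Form n e) :
    (Form.mul h f g : MvPolynomial (Fin n) ℝ) = f * g := rfl

theorem evalAt_mul {n d e k : ℕ} (h : d + e = k) (f : Form n d) (g : Form n e) (x : Fin n → ℝ) :
    evalAt x (Form.mul h f g) = evalAt x f * evalAt x g := by
  simp [evalAt_apply, Form.coe_mul]

/-- The linear form with given coefficient functional. -/
theorem exists_linearForm {n : ℕ} (φ : Module.Dual ℝ (Fin n → ℝ)) :
    ∃ L : Form n 1, ∀ x, evalAt x L = φ x := by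
  refine ⟨⟨∑ i, C (φ (Pi.single i 1)) * X i, ?_⟩, fun x => ?_⟩
  · refine Submodule.sum_mem _ fun i _ => ?_
    exact (isHomogeneous_X ℝ i).C_mul _
  · rw [evalAt_apply]
    simp only [map_sum, map_mul, eval_C, eval_X]
    conv_rhs => rw [pi_eq_sum_univ' x]
    simp [mul_comm, Pi.single]

/-! ### Syzygies of forms meeting transversely -/

/-- Differentiating the syzygy at a common zero leaves a linear relation between the gradients with
coefficients `f i (x)`. -/
theorem coeff_eval_eq_zero_of_syzygy {n r : ℕ} {q f : Fin r → MvPolynomial (Fin n) ℝ}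
    {x : Fin n → ℝ} (hq : ∀ i, eval x (q i) = 0)
    (ht : LinearIndependent ℝ (fun i : Fin r => fun t : Fin n => eval x (pderiv t (q i))))
    (h : ∑ i, f i * q i = 0) (i : Fin r) : eval x (f i) = 0 := by
  refine Fintype.linearIndependent_iff.mp ht (fun i => eval x (f i)) ?_ i
  ext t
  have := congrArg (fun g => eval x (pderiv t g)) h
  simpa [Derivation.leibniz, hq] using this

/-- Each partial derivative of the quadratic relation is again a syzygy of `q`. Its coefficients
vanish at `x` by `coeff_eval_eq_zero_of_syzygy`, which is a second linear relation between the
gradients. -/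
theorem add_swap_eq_zero_of_sum_mul_eq_zero {n r : ℕ} {q : Fin r → MvPolynomial (Fin n) ℝ}
    {x : Fin n → ℝ} (hq : ∀ i, eval x (q i) = 0)
    (ht : LinearIndependent ℝ (fun i : Fin r => fun t : Fin n => eval x (pderiv t (q i))))
    {c : Fin r → Fin r → ℝ} (h : ∑ i, (∑ j, c i j • q j) * q i = 0) (i j : Fin r) :
    c i j + c j i = 0 := by
  have key : ∀ t, ∑ i, (∑ j, (c i j + c j i) • pderiv t (q j)) * q i = 0 := by
    intro t
    have := congrArg (fun g => pderiv t g) h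
    simp only [map_sum, Derivation.leibniz, smul_eq_mul, map_zero,
      Finset.sum_add_distrib] at this
    rw [← this]
    simp only [Finset.sum_mul, add_smul, Finset.sum_add_distrib, add_mul]
    rw [add_comm]
    congr 1
    · rw [Finset.sum_comm]
      refine Finset.sum_congr rfl fun i _ => Finset.sum_congr rfl fun j _ => ?_
      simp only [smul_eq_C_mul]; ring
    · refine Finset.sum_congr rfl fun i _ => ?_
      rw [Finset.mul_sum]
      refine Finset.sum_congr rfl fun j _ => ?_
      rw [Derivation.map_smul]
      simp only [smul_eq_C_mul]; ring
  refine Fintype.linearIndependent_iff.mp ht (fun j => c i j + c j i) ?_ j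
  ext t
  have := coeff_eval_eq_zero_of_syzygy hq ht (key t) i
  simpa [smul_eq_C_mul] using this

/-- The values of a form at finitely many points. -/
def evalMap {n m : ℕ} (d : ℕ) (v : Fin m → Fin n → ℝ) : Form n d →ₗ[ℝ] (Fin m → ℝ) :=
  LinearMap.pi fun j => evalAt (v j)

@[simp] theorem evalMap_apply {n m d : ℕ} (v : Fin m → Fin n → ℝ) (f : Form n d) (j : Fin m) :
    evalMap d v f j = evalAt (v j) f := rfl

/-- The linear map `(f_i) ↦ ∑ f_i q_i`. -/
def syzygyMap {n d e k r : ℕ} (h : d + e = k) (q : Fin r → Form n e) :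
    (Fin r → Form n d) →ₗ[ℝ] Form n k where
  toFun f := ∑ i, Form.mul h (f i) (q i)
  map_add' f g := by
    ext1
    simp [Form.coe_mul, add_mul, Finset.sum_add_distrib]
  map_smul' c f := by
    ext1
    simp [Form.coe_mul, Finset.smul_sum]

theorem coe_syzygyMap {n d e k r : ℕ} (h : d + e = k) (q : Fin r → Form n e)
    (f : Fin r → Form n d) :
    (syzygyMap h q f : MvPolynomial (Fin n) ℝ) = ∑ i, (f i * q i : MvPolynomial (Fin n) ℝ) := by
  simp [syzygyMap, Form.coe_mul]

/-- The linear map sending the strict upper triangle of an antisymmetric matrix `c` to the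
Koszul syzygy `(∑ j, c i j • q j)_i`. -/
def koszulMap {r : ℕ} {E : Type*} [AddCommGroup E] [Module ℝ E] (q : Fin r → E) :
    ({p : Fin r × Fin r // p.1 < p.2} → ℝ) →ₗ[ℝ] (Fin r → E) where
  toFun c := fun i => ∑ j, (if h : i < j then c ⟨(i, j), h⟩ else
    if h : j < i then - c ⟨(j, i), h⟩ else 0) • q j
  map_add' c c' := by
    ext i
    simp only [Pi.add_apply]
    rw [← Finset.sum_add_distrib]
    refine Finset.sum_congr rfl fun j _ => ?_
    split_ifs <;> simp [add_smul]; abel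
  map_smul' s c := by
    ext i
    simp only [Pi.smul_apply, Finset.smul_sum, RingHom.id_apply]
    refine Finset.sum_congr rfl fun j _ => ?_
    split_ifs <;> simp [mul_smul]

theorem exists_koszulMap_eq {r : ℕ} {E : Type*} [AddCommGroup E] [Module ℝ E] (q : Fin r → E)
    {c : Fin r → Fin r → ℝ} (hc : ∀ i j, c i j + c j i = 0) :
    ∃ b, koszulMap q b = fun i => ∑ j, c i j • q j := by
  refine ⟨fun p => c p.1.1 p.1.2, ?_⟩
  funext i
  simp only [koszulMap, LinearMap.coe_mk, AddHom.coe_mk]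
  refine Finset.sum_congr rfl fun j _ => ?_
  congr 1
  split_ifs with h1 h2
  · rfl
  · linarith [hc i j]
  · obtain rfl : i = j := le_antisymm (not_lt.mp h2) (not_lt.mp h1)
    linarith [hc i i]

/-- `w` is a linear relation between the values of forms of degree `d` at the points `v j`. -/
def IsRelation {n m : ℕ} (d : ℕ) (v : Fin m → Fin n → ℝ) (w : Fin m → ℝ) : Prop :=
  ∀ f : Form n d, ∑ j, w j * evalAt (v j) f = 0

/-- Every nonzero linear relation between the values of forms of degree `d` at the points `v j`
involves all the points. -/
def RelationsHaveFullSupport {n m : ℕ} (d : ℕ) (v : Fin m → Fin n → ℝ) : Prop :=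
  ∀ w : Fin m → ℝ, IsRelation d v w → ∀ z, w z = 0 → w = 0

/-! ### Relations of full support and interpolation at the points -/

section Relations

variable {n m d r : ℕ} {v : Fin (m + 1) → Fin n → ℝ} {u w y : Fin (m + 1) → ℝ}

theorem RelationsHaveFullSupport.ne_zero (hv : RelationsHaveFullSupport d v)
    (hu : IsCayleyBacharachRelation d v u) (j : Fin (m + 1)) : u j ≠ 0 :=
  fun h => hu.1 (hv u hu.2 j h)

theorem RelationsHaveFullSupport.exists_eq_smul (hv : RelationsHaveFullSupport d v)
    (hu : IsCayleyBacharachRelation d v u) (hw : IsRelation d v w) : ∃ c : ℝ, w = c • u := by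
  refine ⟨w 0 / u 0, sub_eq_zero.mp (hv _ (fun f => ?_) 0 ?_)⟩
  · have h : ∑ j, (w j * evalAt (v j) f - w 0 / u 0 * (u j * evalAt (v j) f)) = 0 := by
      rw [Finset.sum_sub_distrib, ← Finset.mul_sum, hw f, hu.2 f]; simp
    rw [← h]
    refine Finset.sum_congr rfl fun j _ => ?_
    simp only [Pi.sub_apply, Pi.smul_apply, smul_eq_mul]; ring
  · simp [hv.ne_zero hu 0]

/-- A functional vanishing on the image of evaluation is a relation, hence a multiple of `u`; so `u`
gives the only obstruction to interpolation. -/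
theorem RelationsHaveFullSupport.exists_evalMap_eq (hv : RelationsHaveFullSupport d v)
    (hu : IsCayleyBacharachRelation d v u) (hy : ∑ j, u j * y j = 0) :
    ∃ f : Form n d, evalMap d v f = y := by
  by_contra hcon
  have hy' : y ∉ LinearMap.range (evalMap d v) := fun ⟨f, hf⟩ => hcon ⟨f, hf⟩
  obtain ⟨φ, hφ, hle⟩ := Submodule.exists_le_ker_of_notMem hy'
  have hφ' : ∀ x, φ x = ∑ j, φ (Pi.single j 1) * x j := by
    intro x
    conv_lhs => rw [pi_eq_sum_univ' x]
    simp [mul_comm, Pi.single]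
  obtain ⟨c, hc⟩ := hv.exists_eq_smul hu (w := fun j => φ (Pi.single j 1)) fun f => by
    have := hle ⟨f, rfl⟩
    rw [LinearMap.mem_ker, hφ'] at this
    simpa using this
  apply hφ
  have hc' : ∀ j, φ (Pi.single j 1) = c * u j := fun j => congrFun hc j
  rw [hφ']
  simp only [hc', mul_assoc]
  rw [← Finset.mul_sum, hy, mul_zero]

theorem RelationsHaveFullSupport.finrank_ker_evalMap (hv : RelationsHaveFullSupport d v)
    (hu : IsCayleyBacharachRelation d v u) :
    m + Module.finrank ℝ (LinearMap.ker (evalMap d v)) = Module.finrank ℝ (Form n d) := by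
  let φ : Module.Dual ℝ (Fin (m + 1) → ℝ) := ∑ j, u j • LinearMap.proj j
  have hφ : ∀ x, φ x = ∑ j, u j * x j := fun x => by simp [φ]
  have hne : φ ≠ 0 := fun h => hv.ne_zero hu 0 (by
    have := hφ (Pi.single 0 1)
    rw [h] at this
    simpa [Pi.single_apply] using this.symm)
  have hr : LinearMap.range (evalMap d v) = LinearMap.ker φ := by
    ext x
    rw [LinearMap.mem_ker, hφ]
    constructor
    · rintro ⟨f, rfl⟩
      simpa using hu.2 f
    · intro hx
      exact hv.exists_evalMap_eq hu hx
  have h1 := Module.Dual.finrank_ker_add_one_of_ne_zero hne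
  have h2 := (evalMap d v).finrank_range_add_finrank_ker
  rw [hr] at h2
  simp only [Module.finrank_fintype_fun_eq_card, Fintype.card_fin] at h1
  omega

theorem RelationsHaveFullSupport.exists_evalMap_pair (hv : RelationsHaveFullSupport d v)
    (hu : IsCayleyBacharachRelation d v u) {i k : Fin (m + 1)} (hik : i ≠ k) :
    ∃ f : Form n d, ∀ j, evalAt (v j) f = if j = i then u k else if j = k then - u i else 0 := by
  obtain ⟨f, hf⟩ := hv.exists_evalMap_eq hu
    (y := fun j => if j = i then u k else if j = k then - u i else 0) (by
      rw [Finset.sum_eq_add_of_mem i k (Finset.mem_univ _) (Finset.mem_univ _) hik]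
      · simp [hik.symm]; ring
      · intro c _ hc
        simp [hc.1, hc.2])
  exact ⟨f, fun j => congrFun hf j⟩

/-- The points impose independent conditions in any degree `2d` if all relations in degree `d`
have full support. -/
theorem RelationsHaveFullSupport.eq_zero_of_isRelation (hv : RelationsHaveFullSupport d v)
    (hu : IsCayleyBacharachRelation d v u) (hm : 2 ≤ m) (hw : IsRelation (2 * d) v w) :
    w = 0 := by
  ext i
  obtain ⟨k, hk⟩ : ∃ k : Fin (m + 1), i ≠ k := by
    have : Nontrivial (Fin (m + 1)) := Fin.nontrivial_iff_two_le.mpr (by omega)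
    exact (exists_ne i).imp fun _ => Ne.symm
  obtain ⟨l, hli, hlk⟩ : ∃ l : Fin (m + 1), l ≠ i ∧ l ≠ k := by
    have : ({i, k} : Finset (Fin (m + 1))).card < Fintype.card (Fin (m + 1)) := by
      have := Finset.card_le_two (a := i) (b := k)
      rw [Fintype.card_fin]; omega
    obtain ⟨l, -, hl⟩ := Finset.exists_mem_notMem_of_card_lt_card
      (s := {i, k}) (t := Finset.univ) (by simpa using this)
    exact ⟨l, by simpa using hl⟩
  obtain ⟨g, hg⟩ := hv.exists_evalMap_pair hu hk
  -- Multiplying by `g`, supported at `i` and `k` only, turns `w` into a degree `d` relation that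
  -- misses `l`.
  have h := hv (fun j => w j * evalAt (v j) g) (fun f => by
    have := hw (Form.mul (two_mul d).symm g f)
    simpa [evalAt_mul, mul_assoc] using this) l (by simp [hg, hli, hlk])
  have := congrFun h i
  simpa [hg, hv.ne_zero hu k] using this

end Relations

/-! ### Forms of degree `2d` vanishing at the points -/

section Transverse

variable {n m d r : ℕ} {v : Fin (m + 1) → Fin n → ℝ} {q : Fin r → Form n d}
  {u : Fin (m + 1) → ℝ}

theorem IsTransverseIntersection.ne_zero (hq : IsTransverseIntersection q v) (hm : 1 ≤ m)
    (j : Fin (m + 1)) : v j ≠ 0 := by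
  have : Nontrivial (Fin (m + 1)) := Fin.nontrivial_iff_two_le.mpr (by omega)
  obtain ⟨i, hi⟩ := exists_ne j
  exact (hq.distinct j i hi.symm).ne_zero 0

theorem IsTransverseIntersection.evalAt_eq_zero (hq : IsTransverseIntersection q v) (hm : 1 ≤ m)
    (i : Fin r) (j : Fin (m + 1)) : evalAt (v j) (q i) = 0 := by
  have hz : (fun t => (v j t : ℂ)) ≠ 0 := fun h => hq.ne_zero hm j (by
    ext t
    exact Complex.ofReal_eq_zero.mp (congrFun h t))
  have h := (hq.zeros _ hz).mpr ⟨j, 1, by simp⟩ i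
  have h2 : (fun t => (v j t : ℂ)) = fun t => algebraMap ℝ ℂ (v j t) := rfl
  rw [h2, ← Function.comp_def, MvPolynomial.aeval_algebraMap_apply] at h
  rw [evalAt_apply, ← MvPolynomial.aeval_eq_eval]
  exact Complex.ofReal_eq_zero.mp h

theorem IsTransverseIntersection.linearIndependent (hq : IsTransverseIntersection q v) :
    LinearIndependent ℝ q := by
  rw [Fintype.linearIndependent_iff]
  intro g hg
  refine Fintype.linearIndependent_iff.mp (hq.transverse 0) g ?_
  ext t
  have := congrArg (fun f : Form n d => eval (v 0) (pderiv t (f : MvPolynomial (Fin n) ℝ))) hg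
  simpa [smul_eq_C_mul] using this

/-- The image of evaluation has dimension `m`, so by `hD` the forms vanishing at all points have
dimension `r`, the number of the independent `q i`. -/
theorem IsTransverseIntersection.exists_eq_sum (hq : IsTransverseIntersection q v) (hm : 1 ≤ m)
    (hv : RelationsHaveFullSupport d v) (hu : IsCayleyBacharachRelation d v u)
    (hD : Module.finrank ℝ (Form n d) = r + m) {f : Form n d} (hf : ∀ j, evalAt (v j) f = 0) :
    ∃ c : Fin r → ℝ, ∑ i, c i • q i = f := by
  have hle : Submodule.span ℝ (Set.range q) ≤ LinearMap.ker (evalMap d v) := by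
    rw [Submodule.span_le]
    rintro _ ⟨i, rfl⟩
    ext j
    exact hq.evalAt_eq_zero hm i j
  have heq := Submodule.eq_of_le_of_finrank_eq hle (by
    have h1 := finrank_span_eq_card hq.linearIndependent
    have h2 := hv.finrank_ker_evalMap hu
    rw [Fintype.card_fin] at h1
    omega)
  rw [← Submodule.mem_span_range_iff_exists_fun ℝ, heq]
  ext j
  exact hf j

/-- Every degree `d` syzygy is Koszul: its coefficients vanish at the points, so they are constant
combinations of the `q i`, and the matrix of constants is antisymmetric. -/
theorem IsTransverseIntersection.finrank_ker_syzygyMap_le (hq : IsTransverseIntersection q v)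
    (hm : 1 ≤ m) (hv : RelationsHaveFullSupport d v) (hu : IsCayleyBacharachRelation d v u)
    (hD : Module.finrank ℝ (Form n d) = r + m) :
    Module.finrank ℝ (LinearMap.ker (syzygyMap (two_mul d).symm q)) ≤
      Fintype.card {p : Fin r × Fin r // p.1 < p.2} := by
  have hq0 : ∀ i j, eval (v j) (q i : MvPolynomial (Fin n) ℝ) = 0 := fun i j => by
    rw [← evalAt_apply]; exact hq.evalAt_eq_zero hm i j
  have hle : LinearMap.ker (syzygyMap (two_mul d).symm q) ≤ LinearMap.range (koszulMap q) := by
    intro f hf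
    have hf' : ∑ i, (f i : MvPolynomial (Fin n) ℝ) * (q i : MvPolynomial (Fin n) ℝ) = 0 := by
      rw [← coe_syzygyMap (two_mul d).symm, LinearMap.mem_ker.mp hf]; rfl
    have hfv : ∀ i j, evalAt (v j) (f i) = 0 := fun i j => by
      rw [evalAt_apply]
      exact coeff_eval_eq_zero_of_syzygy (fun i => hq0 i j) (hq.transverse j) hf' i
    choose c hc using fun i => hq.exists_eq_sum hm hv hu hD (hfv i)
    obtain ⟨b, hb⟩ := exists_koszulMap_eq q (c := c) (fun i j => by
      refine add_swap_eq_zero_of_sum_mul_eq_zero (fun i => hq0 i 0) (hq.transverse 0) ?_ i j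
      rw [← hf']
      refine Finset.sum_congr rfl fun i _ => ?_
      rw [← hc i]
      simp)
    exact ⟨b, hb.trans (funext hc)⟩
  refine (Submodule.finrank_mono hle).trans ((LinearMap.finrank_range_le _).trans ?_)
  rw [Module.finrank_fintype_fun_eq_card]

/-- The forms of degree `2d` vanishing on the points lie in the ideal of the `q i`. -/
theorem IsTransverseIntersection.exists_syzygyMap_eq (hq : IsTransverseIntersection q v)
    (hm : 2 ≤ m) (hv : RelationsHaveFullSupport d v) (hu : IsCayleyBacharachRelation d v u)
    (hD : Module.finrank ℝ (Form n d) = r + m)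
    (hD2 : Module.finrank ℝ (Form n (2 * d)) + Fintype.card {p : Fin r × Fin r // p.1 < p.2} =
      r * Module.finrank ℝ (Form n d) + (m + 1))
    {F : Form n (2 * d)} (hF : ∀ j, evalAt (v j) F = 0) :
    ∃ f, syzygyMap (two_mul d).symm q f = F := by
  have hsurj : Function.Surjective (evalMap (2 * d) v) := by
    rw [← LinearMap.range_eq_top]
    by_contra hne
    obtain ⟨φ, hφ, hle⟩ := Submodule.exists_le_ker_of_lt_top _ (lt_top_iff_ne_top.mpr hne)
    have hφ' : ∀ x, φ x = ∑ j, φ (Pi.single j 1) * x j := by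
      intro x
      conv_lhs => rw [pi_eq_sum_univ' x]
      simp [mul_comm, Pi.single]
    have h0 := hv.eq_zero_of_isRelation hu hm (w := fun j => φ (Pi.single j 1)) fun f => by
      have := hle ⟨f, rfl⟩
      rw [LinearMap.mem_ker, hφ'] at this
      simpa using this
    apply hφ
    have h0' : ∀ j, φ (Pi.single j 1) = 0 := fun j => congrFun h0 j
    refine LinearMap.ext fun x => ?_
    rw [hφ']
    simp [h0']
  have hle : LinearMap.range (syzygyMap (two_mul d).symm q) ≤
      LinearMap.ker (evalMap (2 * d) v) := by
    rintro _ ⟨f, rfl⟩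
    ext j
    simp [syzygyMap, evalAt_mul, hq.evalAt_eq_zero (by omega : 1 ≤ m)]
  -- `hD2` says that the image of the syzygy map, when only Koszul syzygies are lost, has
  -- codimension `m + 1`, as do the forms vanishing at the points.
  have heq := Submodule.eq_of_le_of_finrank_le hle (by
    have h1 := (evalMap (2 * d) v).finrank_range_add_finrank_ker
    have h2 := (syzygyMap (two_mul d).symm q).finrank_range_add_finrank_ker
    have h3 := hq.finrank_ker_syzygyMap_le (by omega) hv hu hD
    rw [LinearMap.range_eq_top.mpr hsurj, finrank_top] at h1
    simp only [Module.finrank_fintype_fun_eq_card, Fintype.card_fin, Module.finrank_pi_fintype,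
      Finset.sum_const, Finset.card_univ, smul_eq_mul] at h1 h2
    omega)
  have : F ∈ LinearMap.ker (evalMap (2 * d) v) := by
    ext j
    exact hF j
  rw [← heq] at this
  exact this

end Transverse

/-! ### The dual cone and extremality -/

theorem pointFunctional_apply {n m d : ℕ} (v : Fin m → Fin n → ℝ) (a : Fin m → ℝ)
    (f : Form n d) : pointFunctional d v a f = ∑ j, a j * evalAt (v j) f := by
  simp [pointFunctional, LinearMap.sum_apply]

theorem Form.mul_self_mem_sosCone {n d : ℕ} (f : Form n d) :
    Form.mul (two_mul d).symm f f ∈ sosCone n d :=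
  ⟨1, fun _ => f, by simp [Form.coe_mul, sq]⟩

theorem mem_sosDual_of_forall_mul_self {n d : ℕ} {l : Module.Dual ℝ (Form n (2 * d))}
    (h : ∀ f, 0 ≤ l (Form.mul (two_mul d).symm f f)) : l ∈ sosDual n d := by
  rintro F ⟨r, g, hg⟩
  have : F = ∑ i, Form.mul (two_mul d).symm (g i) (g i) := by
    ext1
    simp [hg, Form.coe_mul, sq]
  rw [this, map_sum]
  exact Finset.sum_nonneg fun i _ => h _

/-- An isotropic vector of a positive semidefinite form lies in its radical: `l((tw + f)²)` is
affine in `t` and bounded below. -/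
theorem apply_mul_eq_zero_of_mem_sosDual {n d : ℕ} {l : Module.Dual ℝ (Form n (2 * d))}
    (hl : l ∈ sosDual n d) {w : Form n d} (hw : l (Form.mul (two_mul d).symm w w) = 0)
    (f : Form n d) : l (Form.mul (two_mul d).symm w f) = 0 := by
  have key : ∀ t : ℝ, 0 ≤ 2 * t * l (Form.mul (two_mul d).symm w f) +
      l (Form.mul (two_mul d).symm f f) := by
    intro t
    have h := hl _ (Form.mul_self_mem_sosCone (t • w + f))
    have h2 : Form.mul (two_mul d).symm (t • w + f) (t • w + f) =
        (t ^ 2) • Form.mul (two_mul d).symm w w + (2 * t) • Form.mul (two_mul d).symm w f +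
          Form.mul (two_mul d).symm f f := by
      ext1
      simp only [Form.coe_mul, Submodule.coe_add, Submodule.coe_smul, smul_eq_C_mul, map_mul,
        map_pow, map_ofNat]
      ring
    rw [h2, map_add, map_add, map_smul, map_smul, hw] at h
    simpa using h
  by_contra hne
  -- This value of `t` makes the affine function equal to `-1`.
  have := key (-(l (Form.mul (two_mul d).symm f f) + 1) /
    (2 * l (Form.mul (two_mul d).symm w f)))
  have h3 : 2 * (-(l (Form.mul (two_mul d).symm f f) + 1) /
    (2 * l (Form.mul (two_mul d).symm w f))) * l (Form.mul (two_mul d).symm w f) =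
      -(l (Form.mul (two_mul d).symm f f) + 1) := by
    field_simp
  linarith

section Certificate

variable {n m d r : ℕ} {v : Fin (m + 1) → Fin n → ℝ} {q : Fin r → Form n d}
  {u a : Fin (m + 1) → ℝ}

theorem pointFunctional_mul_self_nonneg (hu : IsRelation d v u)
    (ha : ∀ j : Fin m, 0 < a j.castSucc)
    (hS : 0 < ∑ j : Fin m, u j.castSucc ^ 2 / a j.castSucc)
    (hal : a (Fin.last m) = blekhermanLast u fun j => a j.castSucc) (f : Form n d) :
    0 ≤ pointFunctional (2 * d) v a (Form.mul (two_mul d).symm f f) := by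
  have h1 := hu f
  rw [Fin.sum_univ_castSucc] at h1
  have h2 : (∑ j : Fin m, u j.castSucc * evalAt (v j.castSucc) f) ^ 2 ≤
      (∑ j : Fin m, u j.castSucc ^ 2 / a j.castSucc) *
        ∑ j : Fin m, a j.castSucc * evalAt (v j.castSucc) f ^ 2 := by
    refine Finset.sum_sq_le_sum_mul_sum_of_sq_le_mul _ (fun j _ => ?_) (fun j _ => ?_)
      fun j _ => ?_
    · have := ha j
      positivity
    · have := ha j
      positivity
    · have := (ha j).ne'
      refine le_of_eq ?_
      field_simp
  have h3 : ∑ j : Fin m, u j.castSucc * evalAt (v j.castSucc) f =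
      -(u (Fin.last m) * evalAt (v (Fin.last m)) f) := by linarith
  rw [h3] at h2
  rw [pointFunctional_apply, Fin.sum_univ_castSucc, hal, blekhermanLast]
  simp only [evalAt_mul, ← sq]
  have h4 : (u (Fin.last m) * evalAt (v (Fin.last m)) f) ^ 2 /
      (∑ j : Fin m, u j.castSucc ^ 2 / a j.castSucc) ≤
        ∑ j : Fin m, a j.castSucc * evalAt (v j.castSucc) f ^ 2 := by
    rw [div_le_iff₀ hS]
    linarith
  have h5 : -(u (Fin.last m) ^ 2) / (∑ j : Fin m, u j.castSucc ^ 2 / a j.castSucc) *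
      evalAt (v (Fin.last m)) f ^ 2 = -((u (Fin.last m) * evalAt (v (Fin.last m)) f) ^ 2 /
      (∑ j : Fin m, u j.castSucc ^ 2 / a j.castSucc)) := by ring
  linarith

theorem spansExtremeRay_pointFunctional (hq : IsTransverseIntersection q v)
    (hm : 2 ≤ m) (hv : RelationsHaveFullSupport d v) (hu : IsCayleyBacharachRelation d v u)
    (hD : Module.finrank ℝ (Form n d) = r + m)
    (hD2 : Module.finrank ℝ (Form n (2 * d)) + Fintype.card {p : Fin r × Fin r // p.1 < p.2} =
      r * Module.finrank ℝ (Form n d) + (m + 1))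
    (ha : ∀ j : Fin m, 0 < a j.castSucc)
    (hal : a (Fin.last m) = blekhermanLast u fun j => a j.castSucc) :
    SpansExtremeRay (pointFunctional (2 * d) v a) := by
  have hu0 := hv.ne_zero hu
  have hS : 0 < ∑ j : Fin m, u j.castSucc ^ 2 / a j.castSucc := by
    refine Finset.sum_pos (fun j _ => ?_) ⟨⟨0, by omega⟩, Finset.mem_univ _⟩
    have := ha j
    have := hu0 j.castSucc
    positivity
  have hal0 : a (Fin.last m) ≠ 0 := by
    rw [hal]
    exact div_ne_zero (neg_ne_zero.mpr (pow_ne_zero 2 (hu0 _))) hS.ne'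
  have ha0 : ∀ j, a j ≠ 0 := fun j => Fin.lastCases hal0 (fun j => (ha j).ne') j
  have hsum : ∑ j, u j ^ 2 / a j = 0 := by
    have := hu0 (Fin.last m)
    rw [Fin.sum_univ_castSucc, hal, blekhermanLast]
    field_simp
    ring
  obtain ⟨g, hg⟩ := hv.exists_evalMap_eq hu (y := fun j => u j / a j) (by
    rw [← hsum]
    exact Finset.sum_congr rfl fun j _ => by ring)
  have hg' : ∀ j, evalAt (v j) g = u j / a j := fun j => congrFun hg j
  -- A form supported at two points of positive weight; it shows that the functional is nonzero and
  -- fixes the sign of `c`.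
  obtain ⟨e, he⟩ : ∃ e : Form n d,
      0 < pointFunctional (2 * d) v a (Form.mul (two_mul d).symm e e) := by
    let i : Fin (m + 1) := Fin.castSucc ⟨0, by omega⟩
    let k : Fin (m + 1) := Fin.castSucc ⟨1, by omega⟩
    have hik : i ≠ k := by simp [i, k, Fin.ext_iff]
    obtain ⟨e, he⟩ := hv.exists_evalMap_pair hu hik
    refine ⟨e, ?_⟩
    rw [pointFunctional_apply,
      Finset.sum_eq_add_of_mem i k (Finset.mem_univ _) (Finset.mem_univ _) hik]
    · have h1 : 0 < a i := ha _
      have h2 : 0 < a k := ha _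
      have h3 := hu0 i
      have h4 := hu0 k
      simp only [evalAt_mul, he, if_true, hik.symm, if_false]
      have : 0 < u i * u i := mul_self_pos.mpr h3
      have : 0 < u k * u k := mul_self_pos.mpr h4
      nlinarith [mul_pos h1 this, mul_pos h2 ‹0 < u i * u i›]
    · intro c _ hc
      simp [evalAt_mul, he, hc.1, hc.2]
  have main : ∀ l₁ ∈ sosDual n d, ∀ l₂ ∈ sosDual n d, l₁ + l₂ = pointFunctional (2 * d) v a →
      ∃ c : ℝ, 0 ≤ c ∧ l₁ = c • pointFunctional (2 * d) v a := by
    intro l₁ h₁ l₂ h₂ h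
    have kill : ∀ w : Form n d, pointFunctional (2 * d) v a (Form.mul (two_mul d).symm w w) = 0 →
        ∀ f, l₁ (Form.mul (two_mul d).symm w f) = 0 := by
      intro w hw
      refine apply_mul_eq_zero_of_mem_sosDual h₁ ?_
      rw [← h, LinearMap.add_apply] at hw
      linarith [h₁ _ (Form.mul_self_mem_sosCone w), h₂ _ (Form.mul_self_mem_sosCone w)]
    have hle : ⨅ j, LinearMap.ker (evalAt (d := 2 * d) (v j)) ≤ LinearMap.ker l₁ := by
      intro F hF
      rw [Submodule.mem_iInf] at hF
      obtain ⟨f, rfl⟩ := hq.exists_syzygyMap_eq hm hv hu hD hD2 (F := F) hF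
      rw [LinearMap.mem_ker]
      simp only [syzygyMap, LinearMap.coe_mk, AddHom.coe_mk, map_sum]
      refine Finset.sum_eq_zero fun i _ => ?_
      rw [← kill (q i) _ (f i)]
      · congr 1
        exact Subtype.ext (mul_comm _ _)
      · rw [pointFunctional_apply]
        simp [evalAt_mul, hq.evalAt_eq_zero (by omega : 1 ≤ m)]
    obtain ⟨b, hb⟩ := (Submodule.mem_span_range_iff_exists_fun ℝ).mp
      (mem_span_of_iInf_ker_le_ker hle)
    have hl₁ : l₁ = pointFunctional (2 * d) v b := hb.symm
    obtain ⟨c, hc⟩ := hv.exists_eq_smul hu (w := fun j => b j * (u j / a j)) fun f => by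
      have := kill g (by
        rw [pointFunctional_apply, ← hsum]
        refine Finset.sum_congr rfl fun j _ => ?_
        have := ha0 j
        rw [evalAt_mul, hg']
        field_simp) f
      rw [hl₁, pointFunctional_apply] at this
      simpa [evalAt_mul, hg', mul_assoc] using this
    have hbc : b = c • a := by
      ext j
      have h1 : b j * (u j / a j) = c * u j := congrFun hc j
      have h2 := ha0 j
      have h3 := hu0 j
      field_simp at h1
      rw [h1, Pi.smul_apply, smul_eq_mul, mul_comm]
    have hl : l₁ = c • pointFunctional (2 * d) v a := by
      rw [hl₁, hbc]
      simp [pointFunctional, Finset.smul_sum, mul_smul]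
    refine ⟨c, ?_, hl⟩
    have := h₁ _ (Form.mul_self_mem_sosCone e)
    rw [hl, LinearMap.smul_apply, smul_eq_mul] at this
    exact nonneg_of_mul_nonneg_left this he
  refine ⟨mem_sosDual_of_forall_mul_self
    (pointFunctional_mul_self_nonneg hu.2 ha hS hal), fun h0 => ?_,
    fun l₁ h₁ l₂ h₂ h => ⟨main l₁ h₁ l₂ h₂ h, main l₂ h₂ l₁ h₁ (by rw [add_comm, h])⟩⟩
  rw [h0] at he
  exact lt_irrefl _ he

end Certificate

/-! ### Sign at `p` for large `N`, and rationality -/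

section Coefficients

variable {n m d : ℕ} {v : Fin (m + 1) → Fin n → ℝ} {u : Fin (m + 1) → ℝ} {k : ℕ}

theorem explicitCoeff_castSucc (N : ℝ) (j : Fin m) :
    explicitCoeff u k N j.castSucc = if (j : ℕ) < k then N else 1 := by
  simp [explicitCoeff]

theorem explicitCoeff_last (N : ℝ) :
    explicitCoeff u k N (Fin.last m) =
      blekhermanLast u fun j => explicitCoeff u k N j.castSucc := by
  simp [explicitCoeff]

theorem explicitCoeff_castSucc_pos {N : ℝ} (hN : 0 < N) (j : Fin m) :
    0 < explicitCoeff u k N j.castSucc := by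
  rw [explicitCoeff_castSucc]
  split_ifs <;> positivity

/-- For large `N` the functional with the explicit coefficients is negative at `p`. -/
theorem exists_pointFunctional_neg {p : Form n d} (hu : ∀ j, u j ≠ 0) (hk : 1 ≤ k) (hkm : k ≤ m)
    (hp : p ∈ psdCone n d)
    (hz : ∀ j : Fin m, (j : ℕ) < k → evalAt (v j.castSucc) p = 0)
    (h : RelaxationInequality p v u k) :
    ∃ N₀ : ℝ, 0 < N₀ ∧ ∀ N, N₀ ≤ N → pointFunctional d v (explicitCoeff u k N) p < 0 := by
  unfold RelaxationInequality at h
  set S := ∑ j ∈ Finset.univ.filter (fun j : Fin m => k ≤ (j : ℕ)), u j.castSucc ^ 2 with hS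
  set P := ∑ j ∈ Finset.univ.filter (fun j : Fin m => k ≤ (j : ℕ)), evalAt (v j.castSucc) p
    with hP
  set T := ∑ j ∈ Finset.univ.filter (fun j : Fin m => (j : ℕ) < k), u j.castSucc ^ 2 with hT
  have hS0 : 0 ≤ S := Finset.sum_nonneg fun j _ => sq_nonneg _
  have hP0 : 0 ≤ P := Finset.sum_nonneg fun j _ => hp _
  have hT0 : 0 < T := by
    refine Finset.sum_pos (fun j _ => ?_) ⟨⟨0, by omega⟩, by simp; omega⟩
    have := hu j.castSucc
    positivity
  set G := u (Fin.last m) ^ 2 * evalAt (v (Fin.last m)) p with hG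
  have hgap : 0 < G - S * P := by linarith
  -- Negativity at `p` amounts to `P * (T / N + S) < G`, that is `N > P * T / (G - S * P)`; the `+
  -- 1` gives strictness and `N > 0`.
  refine ⟨P * T / (G - S * P) + 1, by positivity, fun N hN => ?_⟩
  have hN0 : 0 < N := lt_of_lt_of_le (by positivity) hN
  have hsplit : ∑ j : Fin m, u j.castSucc ^ 2 / explicitCoeff u k N j.castSucc = T / N + S := by
    rw [← Finset.sum_filter_add_sum_filter_not Finset.univ (fun j : Fin m => (j : ℕ) < k),
      hT, hS, Finset.sum_div]
    congr 1
    · refine Finset.sum_congr rfl fun j hj => ?_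
      rw [explicitCoeff_castSucc, if_pos (Finset.mem_filter.mp hj).2]
    · simp only [not_lt]
      refine Finset.sum_congr rfl fun j hj => ?_
      rw [explicitCoeff_castSucc, if_neg (not_lt.mpr (Finset.mem_filter.mp hj).2), div_one]
  have hsplit2 : ∑ j : Fin m, explicitCoeff u k N j.castSucc * evalAt (v j.castSucc) p = P := by
    rw [← Finset.sum_filter_add_sum_filter_not Finset.univ (fun j : Fin m => (j : ℕ) < k),
      Finset.sum_eq_zero, zero_add]
    · simp only [not_lt]
      refine Finset.sum_congr rfl fun j hj => ?_
      rw [explicitCoeff_castSucc, if_neg (not_lt.mpr (Finset.mem_filter.mp hj).2), one_mul]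
    · intro j hj
      rw [hz j (Finset.mem_filter.mp hj).2, mul_zero]
  rw [pointFunctional_apply, Fin.sum_univ_castSucc, hsplit2, explicitCoeff_last, blekhermanLast,
    hsplit]
  have hden : 0 < T / N + S := by positivity
  have h1 : P * (T / N + S) < G := by
    have h2 : P * T < N * (G - S * P) := by
      rw [← div_lt_iff₀ hgap]
      linarith
    have h3 : P * T / N < G - S * P := by
      rw [div_lt_iff₀ hN0]
      linarith
    calc P * (T / N + S) = P * T / N + S * P := by ring
      _ < G := by linarith
  have h4 : P < G / (T / N + S) := (lt_div_iff₀ hden).mpr h1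
  have h5 : -(u (Fin.last m) ^ 2) / (T / N + S) * evalAt (v (Fin.last m)) p =
      -(G / (T / N + S)) := by rw [hG]; ring
  linarith

theorem eval_monomial_rat {n : ℕ} {x : Fin n → ℝ} (hx : ∀ t, ∃ s : ℚ, x t = s) (c : Fin n →₀ ℕ) :
    ∃ s : ℚ, eval x (monomial c (1 : ℝ)) = s := by
  choose y hy using hx
  refine ⟨c.prod fun t e => y t ^ e, ?_⟩
  rw [eval_monomial, one_mul, Finsupp.prod, Finsupp.prod]
  push_cast
  exact Finset.prod_congr rfl fun t _ => by rw [hy]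

/-- Over rational points, a relation may be replaced by a rational one. -/
theorem IsRelation.exists_rat (hv : ∀ j t, ∃ s : ℚ, v j t = s) (hu : IsRelation d v u)
    {j₀ : Fin (m + 1)} (hj₀ : u j₀ ≠ 0) :
    ∃ w : Fin (m + 1) → ℚ, w j₀ ≠ 0 ∧ IsRelation d v fun j => (w j : ℝ) := by
  -- A `ℚ`-linear map `ℝ → ℚ` applied to `u` entrywise preserves the relations on monomials, whose
  -- values at the points are rational.
  obtain ⟨φ, hφ⟩ : ∃ φ : Module.Dual ℚ ℝ, φ (u j₀) ≠ 0 := by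
    by_contra! hcon
    exact hj₀ ((Module.forall_dual_apply_eq_zero_iff ℚ (u j₀)).mp hcon)
  refine ⟨fun j => φ (u j), hφ, fun f => ?_⟩
  choose s hs using fun (j : Fin (m + 1)) (c : Fin n →₀ ℕ) =>
    eval_monomial_rat (hv j) c
  have hmono : ∀ c : Fin n →₀ ℕ, c.degree = d →
      ∑ j, (φ (u j) : ℝ) * eval (v j) (monomial c (1 : ℝ)) = 0 := by
    intro c hc
    have h1 := hu ⟨monomial c 1, isHomogeneous_monomial _ hc⟩
    simp only [evalAt_apply, hs] at h1
    have h2 := congrArg φ h1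
    rw [map_sum, map_zero] at h2
    have h3 : ∀ j, φ (u j * (s j c : ℝ)) = φ (u j) * s j c := by
      intro j
      have : u j * (s j c : ℝ) = s j c • u j := by rw [Rat.smul_def, mul_comm]
      rw [this, map_smul, smul_eq_mul, mul_comm]
    simp only [h3] at h2
    simp only [hs]
    exact_mod_cast h2
  have hf : ∀ j, evalAt (v j) f = ∑ c ∈ (f : MvPolynomial (Fin n) ℝ).support,
      coeff c (f : MvPolynomial (Fin n) ℝ) * eval (v j) (monomial c (1 : ℝ)) := by
    intro j
    rw [evalAt_apply]
    conv_lhs => rw [(f : MvPolynomial (Fin n) ℝ).as_sum, map_sum]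
    refine Finset.sum_congr rfl fun c _ => ?_
    simp [eval_monomial]
  simp only [hf, Finset.mul_sum]
  rw [Finset.sum_comm]
  refine Finset.sum_eq_zero fun c hc => ?_
  have h4 := hmono c (by
    rw [Finsupp.degree_eq_weight_one]
    exact f.2 (mem_support_iff.mp hc))
  calc _ = coeff c (f : MvPolynomial (Fin n) ℝ) *
      ∑ j, (φ (u j) : ℝ) * eval (v j) (monomial c (1 : ℝ)) := by
        rw [Finset.mul_sum]
        exact Finset.sum_congr rfl fun j _ => by ring
    _ = 0 := by rw [h4, mul_zero]

/-- Blekherman's formula is unchanged when `u` is rescaled, so `u` may be replaced by a proportional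
rational relation. -/
theorem RelationsHaveFullSupport.explicitCoeff_rat (hR : RelationsHaveFullSupport d v)
    (hu : IsCayleyBacharachRelation d v u) (hv : ∀ j t, ∃ s : ℚ, v j t = s) (N : ℚ)
    (j : Fin (m + 1)) : ∃ s : ℚ, explicitCoeff u k (N : ℝ) j = s := by
  have hfirst : ∀ j : Fin m, ∃ s : ℚ, explicitCoeff u k (N : ℝ) j.castSucc = s := by
    intro j
    rw [explicitCoeff_castSucc]
    split_ifs
    · exact ⟨N, rfl⟩
    · exact ⟨1, by simp⟩
  refine Fin.lastCases ?_ hfirst j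
  obtain ⟨w, hw0, hw⟩ := IsRelation.exists_rat hv hu.2 (hR.ne_zero hu 0)
  obtain ⟨c, hc⟩ := hR.exists_eq_smul hu hw
  have hc' : ∀ j, (w j : ℝ) = c * u j := fun j => congrFun hc j
  have hc0 : c ≠ 0 := by
    rintro rfl
    exact hw0 (by simpa using hc' 0)
  have hu' : ∀ j, u j = c⁻¹ * w j := fun j => by rw [hc']; field_simp
  choose s hs using hfirst
  refine ⟨-(w (Fin.last m) ^ 2) / ∑ j : Fin m, w j.castSucc ^ 2 / s j, ?_⟩
  rw [explicitCoeff_last, blekhermanLast]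
  simp only [hs]
  push_cast
  simp only [hc', mul_pow, mul_div_assoc, ← Finset.mul_sum]
  rw [neg_div, neg_div, mul_div_mul_left _ _ (pow_ne_zero 2 hc0)]

end Coefficients

/-- The common form of both parts: `r` forms of degree `d` meeting transversely in `m + 1` points
all of which are needed for every relation in degree `d`. -/
theorem exists_isExtremeCertificate {n m d r k : ℕ} {v : Fin (m + 1) → Fin n → ℝ}
    {q : Fin r → Form n d} {u : Fin (m + 1) → ℝ} {p : Form n (2 * d)}
    (hp : p ∈ psdCone n (2 * d)) (hk : 1 ≤ k) (hkm : k ≤ m) (hz : ZerosAreFirst p v k)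
    (hq : IsTransverseIntersection q v)
    (hm : 2 ≤ m) (hv : RelationsHaveFullSupport d v) (hu : IsCayleyBacharachRelation d v u)
    (hD : Module.finrank ℝ (Form n d) = r + m)
    (hD2 : Module.finrank ℝ (Form n (2 * d)) + Fintype.card {p : Fin r × Fin r // p.1 < p.2} =
      r * Module.finrank ℝ (Form n d) + (m + 1))
    (h : RelaxationInequality p v u k) :
    ∃ N₀ : ℝ,
        (∀ N : ℝ, N₀ ≤ N →
          IsExtremeCertificate (pointFunctional (2 * d) v (explicitCoeff u k N)) p) ∧
        ((∀ j t, ∃ s : ℚ, v j t = s) →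
          ∀ N : ℚ, N₀ ≤ N → ∀ j, ∃ s : ℚ, explicitCoeff u k (N : ℝ) j = s) := by
  obtain ⟨N₀, h0, hneg⟩ := exists_pointFunctional_neg (hv.ne_zero hu) hk hkm hp
    (fun j hj => (hz _ (hq.ne_zero (by omega) _)).mpr ⟨j.castSucc, hj, 1, by simp⟩) h
  exact ⟨N₀, fun N hN => ⟨spansExtremeRay_pointFunctional hq hm hv hu hD hD2
    (explicitCoeff_castSucc_pos (h0.trans_le hN)) (explicitCoeff_last N), hneg N hN⟩,
    fun hr N _ => hv.explicitCoeff_rat hu hr N⟩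

/-! ### Hypersurfaces through few points -/

section Interpolation

variable {n m d : ℕ} {v : Fin m → Fin n → ℝ}

theorem exists_ne_zero_forall_evalAt_eq_zero (v : Fin m → Fin n → ℝ) {s : Finset (Fin m)}
    (h : s.card < Module.finrank ℝ (Form n d)) :
    ∃ f : Form n d, f ≠ 0 ∧ ∀ j ∈ s, evalAt (v j) f = 0 := by
  let E : Form n d →ₗ[ℝ] (s → ℝ) := LinearMap.pi fun j => evalAt (v j)
  have := LinearMap.ker_ne_bot_of_finrank_lt (f := E) (by simpa using h)
  obtain ⟨f, hf, hne⟩ := Submodule.exists_mem_ne_zero_of_ne_bot this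
  exact ⟨f, hne, fun j hj => congrFun (LinearMap.mem_ker.mp hf) ⟨j, hj⟩⟩

/-- If `s` imposes independent conditions and there is exactly one hypersurface through `s`, then
all forms vanishing on `s` are multiples of a given nonzero one. -/
theorem exists_eq_smul_of_separated {s : Finset (Fin m)}
    (hs : Module.finrank ℝ (Form n d) = s.card + 1)
    (hsep : ∀ i ∈ s, ∃ f : Form n d, evalAt (v i) f ≠ 0 ∧ ∀ j ∈ s, j ≠ i → evalAt (v j) f = 0)
    {f g : Form n d} (hf0 : f ≠ 0) (hf : ∀ j ∈ s, evalAt (v j) f = 0)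
    (hg : ∀ j ∈ s, evalAt (v j) g = 0) : ∃ c : ℝ, g = c • f := by
  let E : Form n d →ₗ[ℝ] (s → ℝ) := LinearMap.pi fun j => evalAt (v j)
  have hE : LinearMap.range E = ⊤ := by
    rw [eq_top_iff, ← (Pi.basisFun ℝ s).span_eq, Submodule.span_le]
    rintro _ ⟨i, rfl⟩
    obtain ⟨e, he, he'⟩ := hsep i i.2
    refine ⟨(evalAt (v i) e)⁻¹ • e, ?_⟩
    ext j
    by_cases hj : j = i
    · subst hj
      simp [E, he]
    · have : (j : Fin m) ≠ i := fun h => hj (Subtype.ext h)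
      simp [E, he' j j.2 this, hj]
  have h1 := E.finrank_range_add_finrank_ker
  rw [hE, finrank_top, Module.finrank_fintype_fun_eq_card, Fintype.card_coe, hs] at h1
  have h2 : Module.finrank ℝ (LinearMap.ker E) = 1 := by omega
  have hfE : f ∈ LinearMap.ker E := by ext j; exact hf j j.2
  have hgE : g ∈ LinearMap.ker E := by ext j; exact hg j j.2
  obtain ⟨c, hc⟩ := (finrank_eq_one_iff_of_nonzero' (⟨f, hfE⟩ : LinearMap.ker E)
    (fun h => hf0 (congrArg Subtype.val h))).mp h2 ⟨g, hgE⟩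
  exact ⟨c, (congrArg Subtype.val hc).symm⟩

theorem AtMostOnHypersurface.card_le {c : ℕ} (h : AtMostOnHypersurface d c v) {f : Form n d}
    (hf : f ≠ 0) {s : Finset (Fin m)} (hs : ∀ j ∈ s, evalAt (v j) f = 0) : s.card ≤ c := by
  rw [← Set.ncard_coe_finset]
  exact (Set.ncard_le_ncard (fun j hj => hs j hj)).trans (h f hf)

/-- A relation tested on a form that vanishes at all points of its support but one. -/
theorem IsRelation.mul_eq_zero {w : Fin m → ℝ} (hw : IsRelation d v w) {x : Fin m} {f : Form n d}
    (hf : ∀ j ≠ x, w j ≠ 0 → evalAt (v j) f = 0) : w x * evalAt (v x) f = 0 := by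
  rw [← hw f, Finset.sum_eq_single_of_mem x (Finset.mem_univ x)]
  intro j _ hj
  by_cases h : w j = 0
  · rw [h, zero_mul]
  · rw [hf j hj h, mul_zero]

/-- For two distinct projective points there is a linear form vanishing at the second only. -/
theorem exists_linearForm_separating {x y : Fin n → ℝ} (h : LinearIndependent ℝ ![x, y]) :
    ∃ L : Form n 1, evalAt x L ≠ 0 ∧ evalAt y L = 0 := by
  have hx : x ∉ Submodule.span ℝ {y} := by
    have := (linearIndependent_finCons (x := x) (v := ![y])).mp h
    simpa using this.2
  obtain ⟨φ, hφ, hle⟩ := Submodule.exists_le_ker_of_notMem hx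
  obtain ⟨L, hL⟩ := exists_linearForm φ
  refine ⟨L, by rwa [hL], ?_⟩
  rw [hL]
  exact hle (Submodule.mem_span_singleton_self y)

end Interpolation

/-! ### Lines and conics in the plane -/

section Plane

variable {m : ℕ} {v : Fin m → Fin 3 → ℝ}

/-- The points `v x`, `v i`, `v j` lie on a line. -/
def OnLine (v : Fin m → Fin 3 → ℝ) (x i j : Fin m) : Prop :=
  ∃ L : Form 3 1, L ≠ 0 ∧ evalAt (v x) L = 0 ∧ evalAt (v i) L = 0 ∧ evalAt (v j) L = 0

/-- Both lines pass through the distinct points `v x` and `v i`, so they coincide and contain four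
points. -/
theorem OnLine.false_of_four (hd : ∀ i j, i ≠ j → LinearIndependent ℝ ![v i, v j])
    (h3 : AtMostOnHypersurface 1 3 v) {x i j k : Fin m} (hxi : x ≠ i) (hxj : x ≠ j) (hxk : x ≠ k)
    (hij : i ≠ j) (hik : i ≠ k) (hjk : j ≠ k) (h : OnLine v x i j) (h' : OnLine v x i k) :
    False := by
  obtain ⟨L, hL, hLx, hLi, hLj⟩ := h
  obtain ⟨L', hL', hLx', hLi', hLk'⟩ := h'
  obtain ⟨c, hc⟩ := exists_eq_smul_of_separated (v := v) (s := {x, i}) (f := L) (g := L')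
    (by rw [finrank_form, Finset.card_pair hxi]; rfl)
    (by
      intro y hy
      rcases Finset.mem_insert.mp hy with rfl | hy
      · obtain ⟨M, h1, h2⟩ := exists_linearForm_separating (hd y i hxi)
        refine ⟨M, h1, ?_⟩
        simp [h2]
      · rw [Finset.mem_singleton] at hy
        subst hy
        obtain ⟨M, h1, h2⟩ := exists_linearForm_separating (hd y x hxi.symm)
        refine ⟨M, h1, ?_⟩
        simp [h2]) hL (by simp [hLx, hLi]) (by simp [hLx', hLi'])
  have hLj' : evalAt (v j) L' = 0 := by rw [hc, map_smul, hLj, smul_zero]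
  have := h3.card_le hL' (s := {x, i, j, k}) (by simp [hLx', hLi', hLk', hLj'])
  rw [Finset.card_insert_of_notMem (by simp [*]), Finset.card_insert_of_notMem (by simp [*]),
    Finset.card_pair hjk] at this
  omega

theorem exists_line_avoiding {x i j : Fin m} (h : ¬ OnLine v x i j) :
    ∃ L : Form 3 1, evalAt (v x) L ≠ 0 ∧ evalAt (v i) L = 0 ∧ evalAt (v j) L = 0 := by
  obtain ⟨L, hL, hz⟩ := exists_ne_zero_forall_evalAt_eq_zero (n := 3) (d := 1) v (s := {i, j})
    (lt_of_le_of_lt Finset.card_le_two (by rw [finrank_form]; decide))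
  have hi := hz i (by simp)
  have hj := hz j (by simp)
  exact ⟨L, fun hx => h ⟨L, hL, hx, hi, hj⟩, hi, hj⟩

/-- The conic is a pair of lines through a pairing of the four points. If a line of the pairing
`ab`, `ce` meets `x`, no line of `ac`, `be` does, since four points would be collinear. -/
theorem exists_conic_avoiding (hd : ∀ i j, i ≠ j → LinearIndependent ℝ ![v i, v j])
    (h3 : AtMostOnHypersurface 1 3 v) {x a b c e : Fin m} (hxa : x ≠ a) (hxb : x ≠ b)
    (hxc : x ≠ c) (hxe : x ≠ e) (hab : a ≠ b) (hac : a ≠ c) (hae : a ≠ e) (hbc : b ≠ c)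
    (hbe : b ≠ e) (hce : c ≠ e) :
    ∃ Q : Form 3 2, evalAt (v x) Q ≠ 0 ∧ evalAt (v a) Q = 0 ∧ evalAt (v b) Q = 0 ∧
      evalAt (v c) Q = 0 ∧ evalAt (v e) Q = 0 := by
  have symm : ∀ {i j}, OnLine v x i j → OnLine v x j i :=
    fun ⟨L, h0, h1, h2, h3⟩ => ⟨L, h0, h1, h3, h2⟩
  have key : ∀ {i j k l}, ¬ OnLine v x i j → ¬ OnLine v x k l →
      ∃ Q : Form 3 2, evalAt (v x) Q ≠ 0 ∧ evalAt (v i) Q = 0 ∧ evalAt (v j) Q = 0 ∧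
        evalAt (v k) Q = 0 ∧ evalAt (v l) Q = 0 := by
    intro i j k l h h'
    obtain ⟨L, hL⟩ := exists_line_avoiding h
    obtain ⟨L', hL'⟩ := exists_line_avoiding h'
    refine ⟨Form.mul one_add_one_eq_two L L', ?_⟩
    simp [evalAt_mul, hL, hL']
  by_cases h1 : OnLine v x a b ∨ OnLine v x c e
  · have h2 : ¬ OnLine v x a c := fun h => h1.elim
      (fun h' => h.false_of_four hd h3 hxa hxc hxb hac hab hbc.symm h')
      (fun h' => (symm h).false_of_four hd h3 hxc hxa hxe hac.symm hce hae h')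
    have h4 : ¬ OnLine v x b e := fun h => h1.elim
      (fun h' => h.false_of_four hd h3 hxb hxe hxa hbe hab.symm hae.symm (symm h'))
      (fun h' => (symm h).false_of_four hd h3 hxe hxb hxc hbe.symm hce.symm hbc (symm h'))
    obtain ⟨Q, h⟩ := key h2 h4
    exact ⟨Q, by tauto⟩
  · push Not at h1
    exact key h1.1 h1.2

theorem exists_conic_separating (hd : ∀ i j, i ≠ j → LinearIndependent ℝ ![v i, v j])
    (h3 : AtMostOnHypersurface 1 3 v) {s : Finset (Fin m)} (hs : s.card = 5) {x : Fin m}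
    (hx : x ∈ s) : ∃ Q : Form 3 2, evalAt (v x) Q ≠ 0 ∧ ∀ j ∈ s, j ≠ x → evalAt (v j) Q = 0 := by
  have h4 : (s.erase x).card = 3 + 1 := by rw [Finset.card_erase_of_mem hx, hs]
  obtain ⟨a, t, hat, hst, ht⟩ := Finset.card_eq_succ.mp h4
  obtain ⟨b, c, e, hbc, hbe, hce, rfl⟩ := Finset.card_eq_three.mp ht
  simp only [Finset.mem_insert, Finset.mem_singleton, not_or] at hat
  have hxs : ∀ y, y ∈ s.erase x → x ≠ y := fun y hy => (Finset.ne_of_mem_erase hy).symm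
  rw [← hst] at hxs
  obtain ⟨Q, hQ, ha, hb, hc, he⟩ := exists_conic_avoiding hd h3 (x := x) (a := a) (b := b)
    (c := c) (e := e) (hxs _ (by simp)) (hxs _ (by simp)) (hxs _ (by simp)) (hxs _ (by simp))
    hat.1 hat.2.1 hat.2.2 hbc hbe hce
  refine ⟨Q, hQ, fun j hj hjx => ?_⟩
  have : j ∈ insert a {b, c, e} := hst ▸ Finset.mem_erase.mpr ⟨hjx, hj⟩
  simp only [Finset.mem_insert, Finset.mem_singleton] at this
  rcases this with rfl | rfl | rfl | rfl <;> assumption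

end Plane

/-- Nine points in the plane, no four on a line and no seven on a conic: every relation between
the values of cubics involves all the points. -/
theorem relationsHaveFullSupport_cubics {v : Fin 9 → Fin 3 → ℝ}
    (hd : ∀ i j, i ≠ j → LinearIndependent ℝ ![v i, v j])
    (h3 : AtMostOnHypersurface 1 3 v) (h6 : AtMostOnHypersurface 2 6 v) :
    RelationsHaveFullSupport 3 v := by
  classical
  intro w hw z hz
  by_contra hne
  obtain ⟨x, hx⟩ := Function.ne_iff.mp hne
  have hxz : x ≠ z := by rintro rfl; exact hx hz
  set S : Finset (Fin 9) := Finset.univ \ {x, z} with hS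
  have hScard : S.card = 7 := by
    rw [hS, Finset.card_sdiff_of_subset (Finset.subset_univ _), Finset.card_pair hxz]; rfl
  have hxS : x ∉ S := by simp [hS]
  have hsupp : ∀ j ≠ x, w j ≠ 0 → j ∈ S := by
    intro j hj hwj
    simp only [hS, Finset.mem_sdiff, Finset.mem_univ, true_and, Finset.mem_insert,
      Finset.mem_singleton, not_or]
    exact ⟨hj, by rintro rfl; exact hwj hz⟩
  have hxne : ∀ {j}, j ∈ S → x ≠ j := fun hj h => hxS (h ▸ hj)
  obtain ⟨a, ha⟩ : S.Nonempty := Finset.card_pos.mp (by omega)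
  -- At most one of the six points other than `a` lies on the line through `x` and `a`.
  obtain ⟨b, hb, c, hc, hbc, hxab, hxac⟩ : ∃ b ∈ S.erase a, ∃ c ∈ S.erase a, b ≠ c ∧
      ¬ OnLine v x a b ∧ ¬ OnLine v x a c := by
    have hbad : ((S.erase a).filter fun b => OnLine v x a b).card ≤ 1 := by
      rw [Finset.card_le_one]
      intro b hb c hc
      rw [Finset.mem_filter, Finset.mem_erase] at hb hc
      by_contra hbc
      exact hb.2.false_of_four hd h3 (hxne ha) (hxne hb.1.2) (hxne hc.1.2) hb.1.1.symm
        hc.1.1.symm hbc hc.2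
    have hsum := Finset.card_filter_add_card_filter_not (s := S.erase a) fun b => OnLine v x a b
    rw [Finset.card_erase_of_mem ha, hScard] at hsum
    have hgood : 1 < ((S.erase a).filter fun b => ¬ OnLine v x a b).card := by omega
    obtain ⟨b, hb, c, hc, hbc⟩ := Finset.one_lt_card.mp hgood
    rw [Finset.mem_filter] at hb hc
    exact ⟨b, hb.1, c, hc.1, hbc, hb.2, hc.2⟩
  -- The conic through the other five points of `S`, times the line `ab`, tests the relation at `x`
  -- alone, so the conic must pass through `x`.
  have conic : ∀ b ∈ S.erase a, ¬ OnLine v x a b → ∃ Q : Form 3 2, Q ≠ 0 ∧ evalAt (v x) Q = 0 ∧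
      ∀ j ∈ (S.erase a).erase b, evalAt (v j) Q = 0 := by
    intro b hb hab
    obtain ⟨Q, hQ, hQz⟩ := exists_ne_zero_forall_evalAt_eq_zero (n := 3) (d := 2) v
      (s := (S.erase a).erase b) (by
        rw [finrank_form, Finset.card_erase_of_mem hb, Finset.card_erase_of_mem ha, hScard]
        decide)
    obtain ⟨L, hLx, hLa, hLb⟩ := exists_line_avoiding hab
    refine ⟨Q, hQ, ?_, hQz⟩
    have := hw.mul_eq_zero (x := x) (f := Form.mul rfl Q L) fun j hj hwj => by
      rw [evalAt_mul]
      by_cases h1 : j = a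
      · rw [h1, hLa, mul_zero]
      by_cases h2 : j = b
      · rw [h2, hLb, mul_zero]
      rw [hQz j (by simp [h1, h2, hsupp j hj hwj]), zero_mul]
    rw [evalAt_mul] at this
    simpa [hLx, show w x ≠ 0 from hx] using this
  obtain ⟨Q, hQ, hQx, hQz⟩ := conic b hb hxab
  obtain ⟨Q', hQ', hQx', hQz'⟩ := conic c hc hxac
  set T := ((S.erase a).erase b).erase c with hT
  have hTcard : T.card = 4 := by
    rw [hT, Finset.card_erase_of_mem (Finset.mem_erase.mpr ⟨hbc.symm, hc⟩),
      Finset.card_erase_of_mem hb, Finset.card_erase_of_mem ha, hScard]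
  have hxT : x ∉ T := by simp [hT, hxS]
  have hcard : (insert x T).card = 5 := by rw [Finset.card_insert_of_notMem hxT, hTcard]
  -- The two conics share `x` and the four points of `T`, which determine a conic. Hence they are
  -- proportional, and `Q` contains seven of the points.
  obtain ⟨t, ht⟩ := exists_eq_smul_of_separated (v := v) (s := insert x T) (f := Q') (g := Q)
    (by rw [finrank_form, hcard]; decide)
    (fun i hi => exists_conic_separating hd h3 hcard hi) hQ'
    (by
      intro j hj
      rcases Finset.mem_insert.mp hj with rfl | hj
      · exact hQx'
      · refine hQz' j ?_
        simp only [hT, Finset.mem_erase] at hj ⊢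
        tauto)
    (by
      intro j hj
      rcases Finset.mem_insert.mp hj with rfl | hj
      · exact hQx
      · exact hQz j (Finset.mem_of_mem_erase hj))
  have := h6.card_le hQ (s := insert x (S.erase a)) fun j hj => by
    rcases Finset.mem_insert.mp hj with rfl | hj
    · exact hQx
    by_cases hjb : j = b
    · rw [ht, map_smul, hQz' j (Finset.mem_erase.mpr ⟨hjb ▸ hbc, hj⟩), smul_zero]
    · exact hQz j (Finset.mem_erase.mpr ⟨hjb, hj⟩)
  rw [Finset.card_insert_of_notMem (by simp [hxS]), Finset.card_erase_of_mem ha, hScard] at this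
  omega

/-! ### Splitting six vectors into two bases, and quadrics in space -/

section TwoBases

variable {ι V : Type*} [DecidableEq ι] [AddCommGroup V] [Module ℝ V] {w : ι → V}

theorem linearIndependent_triple {x y z : V} (hx : x ≠ 0) (hy : y ∉ Submodule.span ℝ {x})
    (hz : z ∉ Submodule.span ℝ {x, y}) : LinearIndependent ℝ ![z, x, y] := by
  refine linearIndependent_finCons.mpr ⟨?_, by simpa [Set.pair_comm] using hz⟩
  rw [LinearIndependent.pair_symm_iff]
  exact linearIndependent_finCons.mpr ⟨by simpa using hx, by simpa using hy⟩

theorem span_pair_ne_top (hV : Module.finrank ℝ V = 3) (x y : V) :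
    Submodule.span ℝ {x, y} ≠ ⊤ := by
  classical
  intro h
  have h1 := finrank_span_finset_le_card (R := ℝ) ({x, y} : Finset V)
  have h2 := Finset.card_le_two (a := x) (b := y)
  rw [Finset.coe_pair, Set.finrank, h, finrank_top, hV] at h1
  omega

/-- Six nonzero vectors in a three-dimensional space, no four of them in a common plane, can be
split into two bases. -/
theorem exists_two_bases (hV : Module.finrank ℝ V = 3) {S : Finset ι} (hS : S.card = 6)
    (hw : ∀ i ∈ S, w i ≠ 0)
    (hplane : ∀ W : Submodule ℝ V, W ≠ ⊤ → ∀ T ⊆ S, T.card = 4 → ¬ ∀ i ∈ T, w i ∈ W) :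
    ∃ a b c d e f, S ⊆ {a, b, c, d, e, f} ∧ LinearIndependent ℝ ![w a, w b, w c] ∧
      LinearIndependent ℝ ![w d, w e, w f] := by
  have off : ∀ W : Submodule ℝ V, W ≠ ⊤ → ∀ T ⊆ S, 4 ≤ T.card → ∃ i ∈ T, w i ∉ W := by
    intro W hW T hT hcard
    obtain ⟨T', hT', hc⟩ := Finset.exists_subset_card_eq hcard
    by_contra! hcon
    exact hplane W hW T' (hT'.trans hT) hc fun i hi => hcon i (hT' hi)
  have hsp1 : ∀ x : V, Submodule.span ℝ {x} ≠ ⊤ := fun x => by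
    simpa using span_pair_ne_top hV x x
  obtain ⟨b, hb⟩ : S.Nonempty := Finset.card_pos.mp (by omega)
  obtain ⟨c, hc, hbc⟩ := off _ (hsp1 (w b)) S subset_rfl (by omega)
  obtain ⟨a, ha, habc⟩ := off _ (span_pair_ne_top hV (w b) (w c)) S subset_rfl (by omega)
  have hli := linearIndependent_triple (hw b hb) hbc habc
  have hcb : c ≠ b := by rintro rfl; exact hbc (Submodule.mem_span_singleton_self _)
  have hab : a ≠ b := by rintro rfl; exact habc (Submodule.subset_span (by simp))
  have hac : a ≠ c := by rintro rfl; exact habc (Submodule.subset_span (by simp))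
  set T := ((S.erase a).erase b).erase c with hT
  have hTcard : T.card = 3 := by
    rw [hT, Finset.card_erase_of_mem, Finset.card_erase_of_mem, Finset.card_erase_of_mem ha, hS]
    · exact Finset.mem_erase.mpr ⟨hab.symm, hb⟩
    · exact Finset.mem_erase.mpr ⟨hcb, Finset.mem_erase.mpr ⟨hac.symm, hc⟩⟩
  have hTS : T ⊆ S :=
    (Finset.erase_subset _ _).trans ((Finset.erase_subset _ _).trans (Finset.erase_subset _ _))
  have haT : ∀ y ∈ ({a, b, c} : Finset ι), y ∉ T := by
    intro y hy
    simp only [Finset.mem_insert, Finset.mem_singleton] at hy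
    simp only [hT, Finset.mem_erase]
    tauto
  have hSsub : ∀ y ∈ S, y = a ∨ y = b ∨ y = c ∨ y ∈ T := by
    intro y hy
    simp only [hT, Finset.mem_erase]
    tauto
  -- a plane containing `T` contains none of the other vectors
  have hTW : ∀ W : Submodule ℝ V, W ≠ ⊤ → (∀ i ∈ T, w i ∈ W) → ∀ y ∈ ({a, b, c} : Finset ι),
      w y ∉ W := by
    intro W hW hTW y hy hyW
    have hyS : y ∈ S := by
      simp only [Finset.mem_insert, Finset.mem_singleton] at hy
      rcases hy with rfl | rfl | rfl <;> assumption
    refine hplane W hW (insert y T) (Finset.insert_subset hyS hTS)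
      (by rw [Finset.card_insert_of_notMem (haT y hy), hTcard]) fun i hi => ?_
    rcases Finset.mem_insert.mp hi with rfl | hi
    · exact hyW
    · exact hTW i hi
  obtain ⟨d, hd⟩ : T.Nonempty := Finset.card_pos.mp (by omega)
  have hd0 := hw d (hTS hd)
  obtain ⟨e, he, hde⟩ : ∃ e ∈ T, w e ∉ Submodule.span ℝ {w d} := by
    by_contra! hcon
    refine hTW (Submodule.span ℝ {w d, w a}) (span_pair_ne_top hV _ _) (fun i hi => ?_) a
      (by simp) (Submodule.subset_span (by simp))
    exact Submodule.span_mono (by simp) (hcon i hi)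
  have hed : e ≠ d := by rintro rfl; exact hde (Submodule.mem_span_singleton_self _)
  obtain ⟨f, hf⟩ : ((T.erase d).erase e).Nonempty := by
    rw [← Finset.card_pos, Finset.card_erase_of_mem (Finset.mem_erase.mpr ⟨hed, he⟩),
      Finset.card_erase_of_mem hd, hTcard]
    decide
  rw [Finset.mem_erase, Finset.mem_erase] at hf
  have hTeq : {f, d, e} = T := by
    refine Finset.eq_of_subset_of_card_le ?_ ?_
    · intro y hy
      simp only [Finset.mem_insert, Finset.mem_singleton] at hy
      rcases hy with rfl | rfl | rfl
      · exact hf.2.2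
      · exact hd
      · exact he
    · rw [hTcard, Finset.card_insert_of_notMem (by simp [hf.1, hf.2.1]), Finset.card_pair hed.symm]
  have hall : ∀ y ∈ S, y = a ∨ y = b ∨ y = c ∨ y = f ∨ y = d ∨ y = e := by
    intro y hy
    have := hSsub y hy
    simpa [← hTeq] using this
  -- If the second triple is dependent, exchange `f` with one of `a`, `b`, `c`. Each of these
  -- completes `d`, `e` to a basis, so if all three exchanges fail, `w f` lies in the three
  -- coordinate planes of the basis `a`, `b`, `c` and is zero.
  by_cases hfde : w f ∈ Submodule.span ℝ {w d, w e}
  swap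
  · refine ⟨a, b, c, f, d, e, fun y hy => ?_, hli, linearIndependent_triple hd0 hde hfde⟩
    simpa using hall y hy
  have hW := hTW _ (span_pair_ne_top hV (w d) (w e)) (by
    rw [← hTeq]
    intro i hi
    simp only [Finset.mem_insert, Finset.mem_singleton] at hi
    rcases hi with rfl | rfl | rfl
    · exact hfde
    · exact Submodule.subset_span (by simp)
    · exact Submodule.subset_span (by simp))
  have hLI : ∀ y ∈ ({a, b, c} : Finset ι), LinearIndependent ℝ ![w y, w d, w e] :=
    fun y hy => linearIndependent_triple hd0 hde (hW y hy)
  by_contra! hcon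
  have hpair : ∀ {y z}, LinearIndependent ℝ ![w y, w z] →
      ¬ LinearIndependent ℝ ![w f, w y, w z] → ∃ s t : ℝ, s • w y + t • w z = w f := by
    intro y z h1 h2
    rw [← Submodule.mem_span_pair]
    by_contra h3
    exact h2 (linearIndependent_finCons.mpr ⟨h1, by simpa [Set.pair_comm] using h3⟩)
  have hLbc : LinearIndependent ℝ ![w b, w c] := (linearIndependent_finCons.mp hli).1
  have hz := Fintype.linearIndependent_iff.mp hli
  have hLac : LinearIndependent ℝ ![w a, w c] := by
    rw [LinearIndependent.pair_iff]
    intro s t hst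
    have h := hz ![s, 0, t] (by simpa [Fin.sum_univ_three] using hst)
    exact ⟨h 0, h 2⟩
  have hLab : LinearIndependent ℝ ![w a, w b] := by
    rw [LinearIndependent.pair_iff]
    intro s t hst
    have h := hz ![s, t, 0] (by simpa [Fin.sum_univ_three] using hst)
    exact ⟨h 0, h 1⟩
  obtain ⟨β, γ, h1⟩ := hpair hLbc (hcon a d e f b c (fun y hy => by
    have := hall y hy
    simp only [Finset.mem_insert, Finset.mem_singleton]; tauto) (hLI a (by simp)))
  obtain ⟨α, γ', h2⟩ := hpair hLac (hcon b d e f a c (fun y hy => by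
    have := hall y hy
    simp only [Finset.mem_insert, Finset.mem_singleton]; tauto) (hLI b (by simp)))
  obtain ⟨α', β', h3⟩ := hpair hLab (hcon c d e f a b (fun y hy => by
    have := hall y hy
    simp only [Finset.mem_insert, Finset.mem_singleton]; tauto) (hLI c (by simp)))
  have h4 := hz ![-α, β, γ - γ'] (by
    have := sub_eq_zero.mpr (h1.trans h2.symm)
    rw [← this]
    simp only [Fin.sum_univ_three, Matrix.cons_val]
    module)
  have h5 := hz ![-α', β - β', γ] (by
    have := sub_eq_zero.mpr (h1.trans h3.symm)
    rw [← this]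
    simp only [Fin.sum_univ_three, Matrix.cons_val]
    module)
  have hβ : β = 0 := h4 1
  have hγ : γ = 0 := h5 2
  exact hw f (hTS hf.2.2) (by rw [← h1, hβ, hγ]; simp)

end TwoBases

/-- Eight points in space, no five on a plane: every relation between the values of quadrics
involves all the points. -/
theorem relationsHaveFullSupport_quadrics {v : Fin 8 → Fin 4 → ℝ}
    (hd : ∀ i j, i ≠ j → LinearIndependent ℝ ![v i, v j])
    (h4 : AtMostOnHypersurface 1 4 v) : RelationsHaveFullSupport 2 v := by
  classical
  intro w hw z hz
  by_contra hne
  obtain ⟨x, hx⟩ := Function.ne_iff.mp hne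
  have hxz : x ≠ z := by rintro rfl; exact hx hz
  set S : Finset (Fin 8) := Finset.univ \ {x, z} with hS
  have hScard : S.card = 6 := by
    rw [hS, Finset.card_sdiff_of_subset (Finset.subset_univ _), Finset.card_pair hxz]; rfl
  have hxS : x ∉ S := by simp [hS]
  have hsupp : ∀ j ≠ x, w j ≠ 0 → j ∈ S := by
    intro j hj hwj
    simp only [hS, Finset.mem_sdiff, Finset.mem_univ, true_and, Finset.mem_insert,
      Finset.mem_singleton, not_or]
    exact ⟨hj, by rintro rfl; exact hwj hz⟩
  have hvx : v x ≠ 0 := (hd x z hxz).ne_zero 0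
  let K := Submodule.span ℝ {v x}
  have hV : Module.finrank ℝ ((Fin 4 → ℝ) ⧸ K) = 3 := by
    have h1 := K.finrank_quotient_add_finrank
    rw [finrank_span_singleton hvx, Module.finrank_fintype_fun_eq_card, Fintype.card_fin] at h1
    omega
  -- Projecting from `v x`, a plane with four of the six images would pull back to a plane with five
  -- of the points.
  obtain ⟨a, b, c, d, e, f, hsub, h₁, h₂⟩ := exists_two_bases (w := fun j => K.mkQ (v j)) hV
    hScard (by
      intro i hi h0
      have hix : i ≠ x := fun h => hxS (h ▸ hi)
      have := (linearIndependent_finCons (x := v i) (v := ![v x])).mp (hd i x hix)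
      have h0' : v i ∈ K := by simpa using h0
      exact this.2 (by simpa using h0'))
    (by
      intro W hW T hT hcard hTW
      obtain ⟨φ, hφ, hle⟩ := Submodule.exists_le_ker_of_lt_top W (lt_top_iff_ne_top.mpr hW)
      obtain ⟨L, hL⟩ := exists_linearForm (φ ∘ₗ K.mkQ)
      have hL0 : L ≠ 0 := by
        rintro rfl
        refine hφ (LinearMap.ext fun y => ?_)
        obtain ⟨y, rfl⟩ := K.mkQ_surjective y
        simpa using (hL y).symm
      have := h4.card_le hL0 (s := insert x T) fun j hj => by
        rw [hL]
        rcases Finset.mem_insert.mp hj with rfl | hj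
        · have : K.mkQ (v j) = 0 :=
            (Submodule.Quotient.mk_eq_zero K).mpr (Submodule.mem_span_singleton_self (v j))
          rw [LinearMap.comp_apply, this, map_zero]
        · exact hle (hTW j hj)
      rw [Finset.card_insert_of_notMem fun h => hxS (hT h), hcard] at this
      omega)
  have plane : ∀ {i j k}, LinearIndependent ℝ ![K.mkQ (v i), K.mkQ (v j), K.mkQ (v k)] →
      ∃ L : Form 4 1, evalAt (v x) L ≠ 0 ∧ evalAt (v i) L = 0 ∧ evalAt (v j) L = 0 ∧
        evalAt (v k) L = 0 := by
    intro i j k h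
    have hx' : v x ∉ Submodule.span ℝ {v i, v j, v k} := by
      intro hmem
      obtain ⟨r, s, t, hrst⟩ := Submodule.mem_span_triple.mp hmem
      have h0 : K.mkQ (v x) = 0 :=
        (Submodule.Quotient.mk_eq_zero K).mpr (Submodule.mem_span_singleton_self (v x))
      rw [← hrst] at h0
      have := Fintype.linearIndependent_iff.mp h ![r, s, t] (by
        simpa [Fin.sum_univ_three] using h0)
      have hr : r = 0 := this 0
      have hs : s = 0 := this 1
      have ht : t = 0 := this 2
      exact hvx (by rw [← hrst, hr, hs, ht]; simp)
    obtain ⟨φ, hφ, hle⟩ := Submodule.exists_le_ker_of_notMem hx'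
    obtain ⟨L, hL⟩ := exists_linearForm φ
    refine ⟨L, by rwa [hL], ?_, ?_, ?_⟩ <;> rw [hL] <;>
      exact hle (Submodule.subset_span (by simp))
  obtain ⟨L, hLx, hLa, hLb, hLc⟩ := plane h₁
  obtain ⟨L', hLx', hLd, hLe, hLf⟩ := plane h₂
  -- The two planes cover `S` and miss `v x`, so their product isolates `w x`.
  have := hw.mul_eq_zero (x := x) (f := Form.mul one_add_one_eq_two L L') fun j hj hwj => by
    have := hsub (hsupp j hj hwj)
    simp only [Finset.mem_insert, Finset.mem_singleton] at this
    rw [evalAt_mul]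
    rcases this with rfl | rfl | rfl | rfl | rfl | rfl <;> simp [*]
  rw [evalAt_mul] at this
  exact mul_ne_zero hx (mul_ne_zero hLx hLx') this

end SOSCertificate

end

open SOSCertificate
theorem corollary3p4 :
    -- ternary sextics, nine points
    (∀ (p : Form 3 (2 * 3)) (v : Fin 9 → Fin 3 → ℝ) (q : Fin 2 → Form 3 3)
      (u : Fin 9 → ℝ) (k : ℕ),
      p ∈ psdCone 3 (2 * 3) → p ∉ sosCone 3 3 →
      1 ≤ k → k ≤ 8 → ZerosAreFirst p v k →
      IsTransverseIntersection q v →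
      AtMostOnHypersurface 1 3 v → AtMostOnHypersurface 2 6 v →
      IsCayleyBacharachRelation 3 v u →
      RelaxationInequality p v u k →
      ∃ N₀ : ℝ,
        (∀ N : ℝ, N₀ ≤ N →
          IsExtremeCertificate (pointFunctional (2 * 3) v (explicitCoeff u k N)) p) ∧
        ((∀ j t, ∃ s : ℚ, v j t = s) →
          ∀ N : ℚ, N₀ ≤ N → ∀ j, ∃ s : ℚ, explicitCoeff u k (N : ℝ) j = s)) ∧
    -- quaternary quartics, eight points
    (∀ (p : Form 4 (2 * 2)) (v : Fin 8 → Fin 4 → ℝ) (q : Fin 3 → Form 4 2)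
      (u : Fin 8 → ℝ) (k : ℕ),
      p ∈ psdCone 4 (2 * 2) → p ∉ sosCone 4 2 →
      1 ≤ k → k ≤ 7 → ZerosAreFirst p v k →
      IsTransverseIntersection q v →
      AtMostOnHypersurface 1 4 v →
      IsCayleyBacharachRelation 2 v u →
      RelaxationInequality p v u k →
      ∃ N₀ : ℝ,
        (∀ N : ℝ, N₀ ≤ N →
          IsExtremeCertificate (pointFunctional (2 * 2) v (explicitCoeff u k N)) p) ∧
        ((∀ j t, ∃ s : ℚ, v j t = s) →
          ∀ N : ℚ, N₀ ≤ N → ∀ j, ∃ s : ℚ, explicitCoeff u k (N : ℝ) j = s)) := by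
  refine ⟨fun p v q u k hp _ hk hk8 hz hq h3 h6 hu h => ?_,
    fun p v q u k hp _ hk hk7 hz hq h4 hu h => ?_⟩
  · refine exists_isExtremeCertificate hp hk hk8 hz hq (by norm_num)
      (relationsHaveFullSupport_cubics hq.distinct h3 h6) hu ?_ ?_ h
    -- The counts are `10 = 2 + 8` and `28 + 1 = 2 * 10 + 9`.
    · rw [finrank_form]; decide
    · rw [finrank_form, finrank_form]; decide
  · refine exists_isExtremeCertificate hp hk hk7 hz hq (by norm_num)
      (relationsHaveFullSupport_quadrics hq.distinct h4) hu ?_ ?_ h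
    -- The counts are `10 = 3 + 7` and `35 + 3 = 3 * 10 + 8`.
    · rw [finrank_form]; decide
    · rw [finrank_form, finrank_form]; decide
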